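/- Let $T\in(0,\infty)$ and let $W=(W_t)_{t\in[0,T]}$ be a standard Wiener process on a probability space $(\Omega,\mathcal F,\mathbb P)$. Let $I:L^2([0,T])\to L^2(\Omega)$ be the Wiener–Itô integral, i.e. the unique linear isometry with $I(\mathbf 1_{(0,t]})=W_t$ for all $t\in[0,T]$. Let $C_b^\infty(\mathbb R^n)$ be the space of infinitely differentiable functions $f:\mathbb R^n\to\mathbb R$ which are bounded together with all their partial derivatives. Let $\mathcal S_b$ be the space of random variables $F=f(I(h_1),\ldots,I(h_n))$ with $n\in\mathbb N$, $f\in C_b^\infty(\mathbb R^n)$ and $h_1,\ldots,h_n\in L^2([0,T])$, and let $\mathcal S_{\infty,b}\subset\mathcal S_b$ be the set of those $F$ that have such a representation with $h_1,\ldots,h_n\in C([0,T])$. For $F\in\mathcal S_b$ as above and $\ell\ge 1$, put $$D^\ell F=\sum_{i_1,\ldots,i_\ell=1}^n(\partial^\ell_{i_1,\ldots,i_\ell}f)(I(h_1),\ldots,I(h_n))\,h_{i_1}\otimes\cdots\otimes h_{i_\ell}\in L^2([0,T]^\ell).$$ For an integer $k\ge1$ and $p\in[1,\infty)$, let $\mathbb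 D^{k,p}$ be the closure (the domain of the closed extension of $(D^1,\ldots,D^k)$) of $\mathcal S_b$ with respect to the norm $$\|F\|_{\mathbb D^{k,p}}=\Big(\mathbb E|F|^p+\sum_{\ell=1}^k\mathbb E\|D^\ell F\|^p_{L^2([0,T]^\ell)}\Big)^{1/p}.$$ Let $\mathcal E_{\infty,b}$ be the set of all elementary processes $$g=\sum_{i=0}^{n-1}G_i\mathbf 1_{[t_i,t_{i+1})},\qquad n\in\mathbb N,\ 0=t_0\le t_1\le\cdots\le t_n=T,\ G_0,\ldots,G_{n-1}\in\mathcal S_{\infty,b}.$$ Then for every integer $k\ge1$ and all $p,q\in[1,\infty)$, the space $\mathcal E_{\infty,b}$ is dense in the Bochner space $L^q([0,T],\mathbb D^{k,p})$. -/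

import Mathlib

open MeasureTheory ProbabilityTheory

noncomputable section

namespace WienerMalliavin

variable {Ω : Type*} [MeasurableSpace Ω] {T : ℝ}

/-! ### The Wiener process and the Wiener–Itô integral -/

/-- `W = (W_t)_{t ∈ [0,T]}` is a standard Wiener process under `P`: it starts at zero, its
increments are independent, `W_t - W_s` is centred Gaussian with variance `t - s`, and its paths
are (almost surely) continuous. -/
structure IsWienerProcess (W : Set.Icc (0 : ℝ) T → Ω → ℝ) (P : Measure Ω) : Prop where
  zero : ∀ t : Set.Icc (0 : ℝ) T, (t : ℝ) = 0 → ∀ᵐ ω ∂P, W t ω = 0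
  law_sub : ∀ s t : Set.Icc (0 : ℝ) T, s ≤ t →
    HasLaw (fun ω ↦ W t ω - W s ω) (gaussianReal 0 (Real.toNNReal ((t : ℝ) - s))) P
  indep : HasIndepIncrements W P
  cont : ∀ᵐ ω ∂P, Continuous (fun t ↦ W t ω)

/-- Lebesgue measure on `[0,T]`. -/
abbrev leb (T : ℝ) : Measure ℝ := volume.restrict (Set.Icc 0 T)

/-- The Hilbert space `L²([0,T])`. -/
abbrev L2 (T : ℝ) : Type := Lp ℝ 2 (leb T)

/-- The Hilbert space `L²([0,T]^l)`. -/
abbrev L2Pow (T : ℝ) (l : ℕ) : Type := Lp ℝ 2 (Measure.pi (fun _ : Fin l ↦ leb T))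

/-- The step function `1_{(0,t]}` as an element of `L²([0,T])`. -/
def stepFn (t : Set.Icc (0 : ℝ) T) : L2 T :=
  indicatorConstLp 2 (measurableSet_Ioc (a := (0 : ℝ)) (b := (t : ℝ)))
    (measure_ne_top (leb T) _) (1 : ℝ)

section WienerIntegral

variable {P : Measure Ω} {W : Set.Icc (0 : ℝ) T → Ω → ℝ}

theorem IsWienerProcess.law (hW : IsWienerProcess W P) (t : Set.Icc (0 : ℝ) T) :
    HasLaw (W t) (gaussianReal 0 (Real.toNNReal t)) P := by
  have h0 : (0 : ℝ) ∈ Set.Icc (0 : ℝ) T := ⟨le_rfl, t.2.1.trans t.2.2⟩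
  have h := hW.law_sub ⟨0, h0⟩ t t.2.1
  simp only [sub_zero] at h
  refine h.congr ?_
  filter_upwards [hW.zero ⟨0, h0⟩ rfl] with ω hω
  simp [hω]

theorem IsWienerProcess.memLp (hW : IsWienerProcess W P) (t : Set.Icc (0 : ℝ) T) :
    MemLp (W t) 2 P :=
  (hW.law t).hasGaussianLaw.memLp_two

/-- The random variable `W_t` as an element of `L²(Ω)`. -/
def IsWienerProcess.toL2 (hW : IsWienerProcess W P) (t : Set.Icc (0 : ℝ) T) : Lp ℝ 2 P :=
  (hW.memLp t).toLp (W t)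

/-- The linear map `∑ c_t δ_t ↦ ∑ c_t 1_{(0,t]}`, with range the step functions. -/
def stepMap (T : ℝ) : (Set.Icc (0 : ℝ) T →₀ ℝ) →ₗ[ℝ] L2 T :=
  Finsupp.linearCombination ℝ stepFn

/-- The linear map `∑ c_t δ_t ↦ ∑ c_t W_t`. -/
def IsWienerProcess.valueMap (hW : IsWienerProcess W P) :
    (Set.Icc (0 : ℝ) T →₀ ℝ) →ₗ[ℝ] Lp ℝ 2 P :=
  Finsupp.linearCombination ℝ hW.toL2

theorem inner_stepFn (s t : Set.Icc (0 : ℝ) T) :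
    inner ℝ (stepFn s) (stepFn t) = min (s : ℝ) t := by
  have h : Set.Ioc 0 (s : ℝ) ∩ Set.Ioc 0 (t : ℝ) ∩ Set.Icc 0 T = Set.Ioc 0 (min (s : ℝ) t) := by
    rw [Set.Ioc_inter_Ioc, sup_idem]
    refine Set.inter_eq_left.2 fun x hx ↦ ⟨hx.1.le, ?_⟩
    exact hx.2.trans ((min_le_left _ _).trans s.2.2)
  rw [stepFn, stepFn, L2.real_inner_indicatorConstLp_one_indicatorConstLp_one, Measure.real,
    Measure.restrict_apply (measurableSet_Ioc.inter measurableSet_Ioc), h, Real.volume_Ioc,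
    sub_zero, ENNReal.toReal_ofReal (le_min s.2.1 t.2.1)]

theorem IsWienerProcess.inner_toL2 (hW : IsWienerProcess W P) (s t : Set.Icc (0 : ℝ) T) :
    inner ℝ (hW.toL2 s) (hW.toL2 t) = min (s : ℝ) t := by
  wlog hst : s ≤ t generalizing s t
  · rw [real_inner_comm, this t s (le_of_not_ge hst), min_comm]
  have h0 : (0 : ℝ) ∈ Set.Icc (0 : ℝ) T := ⟨le_rfl, t.2.1.trans t.2.2⟩
  have hP : IsProbabilityMeasure P := (hW.law t).isProbabilityMeasure
  have hmean : ∀ u, P[W u] = 0 := fun u ↦ by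
    rw [(hW.law u).integral_eq, integral_id_gaussianReal]
  have hind := hW.indep.indepFun_eval_sub (r := ⟨0, h0⟩) s.2.1 hst (hW.zero ⟨0, h0⟩ rfl)
  have hcov : cov[W s, W t; P] = s := by
    have h2 : W t = W t - W s + W s := by simp
    rw [h2, covariance_add_right (hW.memLp s) ((hW.memLp t).sub (hW.memLp s)) (hW.memLp s),
      hind.covariance_eq_zero (hW.memLp s) ((hW.memLp t).sub (hW.memLp s)),
      covariance_self (hW.law s).aemeasurable, (hW.law s).variance_eq, variance_id_gaussianReal,
      zero_add, Real.coe_toNNReal _ s.2.1]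
  rw [covariance_eq_sub (hW.memLp s) (hW.memLp t), hmean, zero_mul, sub_zero] at hcov
  rw [min_eq_left (show (s : ℝ) ≤ t from hst), ← hcov, L2.inner_def]
  refine integral_congr_ae ?_
  filter_upwards [(hW.memLp s).coeFn_toLp, (hW.memLp t).coeFn_toLp] with ω h1 h2
  simp only [IsWienerProcess.toL2, h1, h2, Pi.mul_apply, RCLike.inner_apply, conj_trivial]
  ring

theorem IsWienerProcess.norm_valueMap (hW : IsWienerProcess W P)
    (c : Set.Icc (0 : ℝ) T →₀ ℝ) : ‖hW.valueMap c‖ = ‖stepMap T c‖ := by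
  have h : inner ℝ (hW.valueMap c) (hW.valueMap c) = inner ℝ (stepMap T c) (stepMap T c) := by
    simp only [IsWienerProcess.valueMap, stepMap, Finsupp.linearCombination_apply, Finsupp.sum,
      sum_inner, inner_sum, inner_smul_left, inner_smul_right, hW.inner_toL2, inner_stepFn]
  rw [real_inner_self_eq_norm_sq, real_inner_self_eq_norm_sq] at h
  exact (sq_eq_sq₀ (norm_nonneg _) (norm_nonneg _)).1 h

theorem denseRange_stepMap (T : ℝ) : DenseRange (stepMap T) := by
  have hrange : Set.range (stepMap T) =
      (Submodule.span ℝ (Set.range (stepFn (T := T))) : Set (L2 T)) := by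
    rw [← Finsupp.range_linearCombination]
    rfl
  rw [DenseRange, hrange, Submodule.dense_iff_topologicalClosure_eq_top,
    Submodule.topologicalClosure_eq_top_iff, Submodule.eq_bot_iff]
  intro f hf
  have hint : Integrable f (leb T) := (Lp.memLp f).integrable (by norm_num)
  have hstep : ∀ t : Set.Icc (0 : ℝ) T, ∫ x in Set.Ioc 0 (t : ℝ), f x ∂(leb T) = 0 := fun t ↦ by
    have h := (Submodule.mem_orthogonal _ f).1 hf _ (Submodule.subset_span ⟨t, rfl⟩)
    rwa [stepFn, L2.inner_indicatorConstLp_one] at h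
  have hIic : ∀ a : ℝ, ∫ x in Set.Iic a, f x ∂(leb T) = 0 := fun a ↦ by
    rw [Measure.restrict_restrict measurableSet_Iic]
    rcases lt_or_ge (min a T) 0 with h | h
    · have : Set.Iic a ∩ Set.Icc 0 T = ∅ := by
        ext x
        simp only [Set.mem_inter_iff, Set.mem_Iic, Set.mem_Icc, Set.mem_empty_iff_false,
          iff_false]
        rintro ⟨h1, h2, h3⟩
        exact absurd (h2.trans (le_min h1 h3)) (not_le.2 h)
      rw [this, Measure.restrict_empty, integral_zero_measure]
    · have h1 : Set.Iic a ∩ Set.Icc 0 T = Set.Icc 0 (min a T) := by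
        ext x
        simp only [Set.mem_inter_iff, Set.mem_Iic, Set.mem_Icc, le_min_iff]
        tauto
      have h2 : Set.Ioc 0 (min a T) ∩ Set.Icc 0 T = Set.Ioc 0 (min a T) :=
        Set.inter_eq_left.2 fun x hx ↦ ⟨hx.1.le, hx.2.trans (min_le_right _ _)⟩
      have h3 := hstep ⟨min a T, h, min_le_right _ _⟩
      rw [Measure.restrict_restrict measurableSet_Ioc] at h3
      simp only [h2] at h3
      rw [h1, integral_Icc_eq_integral_Ioc, h3]
  have huniv : ∫ x, f x ∂(leb T) = 0 := by
    have h := hIic T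
    rw [Measure.restrict_restrict measurableSet_Iic,
      Set.inter_eq_right.2 fun x hx ↦ hx.2] at h
    exact h
  have hall : ∀ A : Set ℝ, MeasurableSet A → ∫ x in A, f x ∂(leb T) = 0 := by
    intro A hA
    induction A, hA using MeasurableSpace.induction_on_inter
      ((BorelSpace.measurable_eq (α := ℝ)).trans (borel_eq_generateFrom_Iic ℝ))
      isPiSystem_Iic with
    | empty => simp
    | basic A hA =>
      obtain ⟨a, rfl⟩ := hA
      exact hIic a
    | compl A hA h =>
      have := integral_add_compl hA hint
      rw [h, zero_add, huniv] at this
      exact this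
    | iUnion A hd hA h =>
      rw [integral_iUnion hA hd hint.integrableOn]
      simp [h]
  exact Lp.eq_zero_iff_ae_eq_zero.2 (Lp.ae_eq_zero_of_forall_setIntegral_eq_zero f (by norm_num)
    (by norm_num) (fun _ _ _ ↦ hint.integrableOn) fun A hA _ ↦ hall A hA)

/-- The Wiener–Itô integral `I : L²([0,T]) → L²(Ω)`: the unique extension of the linear isometry
`1_{(0,t]} ↦ W_t`, defined on step functions, to a linear isometry on `L²([0,T])`. -/
def IsWienerProcess.integral (hW : IsWienerProcess W P) : L2 T →ₗᵢ[ℝ] Lp ℝ 2 P where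
  toLinearMap := (hW.valueMap.extendOfNorm (stepMap T)).toLinearMap
  norm_map' h := by
    have hc : ∀ x, ‖hW.valueMap x‖ ≤ 1 * ‖stepMap T x‖ := fun x ↦ by
      rw [one_mul, hW.norm_valueMap]
    refine (denseRange_stepMap T).induction_on (p := fun h ↦
      ‖hW.valueMap.extendOfNorm (stepMap T) h‖ = ‖h‖) h
      (isClosed_eq (by fun_prop) (by fun_prop)) fun c ↦ ?_
    rw [LinearMap.extendOfNorm_eq (denseRange_stepMap T) ⟨1, hc⟩, hW.norm_valueMap]

theorem IsWienerProcess.integral_stepFn (hW : IsWienerProcess W P) (t : Set.Icc (0 : ℝ) T) :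
    hW.integral (stepFn t) = hW.toL2 t := by
  have hc : ∀ x, ‖hW.valueMap x‖ ≤ 1 * ‖stepMap T x‖ := fun x ↦ by
    rw [one_mul, hW.norm_valueMap]
  have h := LinearMap.extendOfNorm_eq (denseRange_stepMap T) ⟨1, hc⟩ (Finsupp.single t 1)
  change hW.valueMap.extendOfNorm (stepMap T) (stepFn t) = hW.toL2 t
  simpa only [stepMap, IsWienerProcess.valueMap, Finsupp.linearCombination_single, one_smul]
    using h

end WienerIntegral

/-! ### Smooth random variables and their Malliavin derivatives -/

/-- The partial derivative `∂^l_{i_1,…,i_l} f` of a function `f : ℝⁿ → ℝ`. -/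
def partialDeriv {n l : ℕ} (f : (Fin n → ℝ) → ℝ) (i : Fin l → Fin n) (x : Fin n → ℝ) : ℝ :=
  iteratedFDeriv ℝ l f x (fun j ↦ Pi.single (i j) 1)

/-- The class `C_b^∞(ℝⁿ)`: smooth, and bounded together with all partial derivatives
(the case `l = 0` is the boundedness of `f` itself). -/
structure IsCbSmooth {n : ℕ} (f : (Fin n → ℝ) → ℝ) : Prop where
  smooth : ContDiff ℝ ((⊤ : ℕ∞) : WithTop ℕ∞) f
  bounded : ∀ (l : ℕ) (i : Fin l → Fin n), ∃ C : ℝ, ∀ x, |partialDeriv f i x| ≤ C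

theorem memLp_tensor {l : ℕ} (h : Fin l → L2 T) :
    MemLp (fun x : Fin l → ℝ ↦ ∏ j, h j (x j)) 2 (Measure.pi (fun _ : Fin l ↦ leb T)) := by
  refine (memLp_two_iff_integrable_sq ?_).2 ?_
  · refine Finset.aestronglyMeasurable_fun_prod _ fun j _ ↦ ?_
    exact (Lp.aestronglyMeasurable (h j)).comp_quasiMeasurePreserving
      (Measure.quasiMeasurePreserving_eval _ j)
  · simp only [← Finset.prod_pow]
    exact Integrable.fintype_prod fun j ↦ (Lp.memLp (h j)).integrable_sq

/-- The tensor product `h_1 ⊗ ⋯ ⊗ h_l ∈ L²([0,T]^l)`,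
`(h_1 ⊗ ⋯ ⊗ h_l)(x_1,…,x_l) = h_1(x_1) ⋯ h_l(x_l)`. -/
def tensor {l : ℕ} (h : Fin l → L2 T) : L2Pow T l :=
  (memLp_tensor h).toLp _

theorem IsCbSmooth.continuous_partialDeriv {n l : ℕ} {f : (Fin n → ℝ) → ℝ} (hf : IsCbSmooth f)
    (i : Fin l → Fin n) : Continuous (partialDeriv f i) := by
  have h : Continuous (iteratedFDeriv ℝ l f) :=
    hf.smooth.continuous_iteratedFDeriv (by exact_mod_cast le_top)
  unfold partialDeriv
  fun_prop

section Smooth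

variable {P : Measure Ω} {W : Set.Icc (0 : ℝ) T → Ω → ℝ}

/-- The random variable `F = f(I(h_1),…,I(h_n))`. -/
def smoothFun (hW : IsWienerProcess W P) {n : ℕ} (f : (Fin n → ℝ) → ℝ) (h : Fin n → L2 T) :
    Ω → ℝ :=
  fun ω ↦ f (fun m ↦ hW.integral (h m) ω)

/-- The `l`-th Malliavin derivative of `F = f(I(h_1),…,I(h_n))`, the `L²([0,T]^l)`-valued random
variable `∑_{i_1,…,i_l} (∂^l_{i_1,…,i_l} f)(I(h_1),…,I(h_n)) h_{i_1} ⊗ ⋯ ⊗ h_{i_l}`. -/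
def smoothDeriv (hW : IsWienerProcess W P) {n : ℕ} (f : (Fin n → ℝ) → ℝ) (h : Fin n → L2 T)
    (l : ℕ) : Ω → L2Pow T l :=
  fun ω ↦ ∑ i : Fin l → Fin n,
    partialDeriv f i (fun m ↦ hW.integral (h m) ω) • tensor (fun j ↦ h (i j))

theorem memLp_smoothDeriv [IsFiniteMeasure P] (hW : IsWienerProcess W P) (p : ENNReal) {n : ℕ}
    {f : (Fin n → ℝ) → ℝ} (hf : IsCbSmooth f) (h : Fin n → L2 T) (l : ℕ) :
    MemLp (smoothDeriv hW f h l) p P := by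
  refine memLp_finsetSum _ fun i _ ↦ ?_
  have hm : MemLp (fun ω ↦ partialDeriv f i (fun m ↦ hW.integral (h m) ω)) p P := by
    obtain ⟨C, hC⟩ := hf.bounded l i
    refine MemLp.of_bound ?_ C (Filter.Eventually.of_forall fun ω ↦ hC _)
    refine (hf.continuous_partialDeriv i).comp_aestronglyMeasurable ?_
    exact (aemeasurable_pi_lambda _ fun m ↦
      (Lp.aestronglyMeasurable (hW.integral (h m))).aemeasurable).aestronglyMeasurable
  exact (ContinuousLinearMap.toSpanSingleton ℝ (tensor fun j ↦ h (i j))).comp_memLp' hm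

theorem memLp_smoothFun [IsFiniteMeasure P] (hW : IsWienerProcess W P) (p : ENNReal) {n : ℕ}
    {f : (Fin n → ℝ) → ℝ} (hf : IsCbSmooth f) (h : Fin n → L2 T) :
    MemLp (smoothFun hW f h) p P := by
  obtain ⟨C, hC⟩ := hf.bounded 0 Fin.elim0
  refine MemLp.of_bound ?_ C (Filter.Eventually.of_forall fun ω ↦ ?_)
  · refine hf.smooth.continuous.comp_aestronglyMeasurable ?_
    exact (aemeasurable_pi_lambda _ fun m ↦
      (Lp.aestronglyMeasurable (hW.integral (h m))).aemeasurable).aestronglyMeasurable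
  · simpa [partialDeriv, smoothFun] using hC (fun m ↦ hW.integral (h m) ω)

end Smooth

/-! ### The Sobolev–Watanabe spaces -/

/-- The product space `L^p(Ω) × L^p(Ω; L²([0,T])) × ⋯ × L^p(Ω; L²([0,T]^k))` in which
`(F, D¹F, …, D^k F)` takes its values, with the norm
`(E|F|^p + ∑_{l=1}^k E‖D^l F‖^p)^{1/p}`. -/
abbrev Jet (T : ℝ) (P : Measure Ω) (p : ENNReal) (k : ℕ) : Type _ :=
  WithLp p (Lp ℝ p P × PiLp p (fun l : Fin k ↦ Lp (L2Pow T ((l : ℕ) + 1)) p P))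

variable {P : Measure Ω} [IsFiniteMeasure P] {W : Set.Icc (0 : ℝ) T → Ω → ℝ}

/-- `(F, D¹F, …, D^k F)` for the smooth random variable `F = f(I(h_1),…,I(h_n))`. -/
def smoothJet (hW : IsWienerProcess W P) (p : ENNReal) (k : ℕ) {n : ℕ}
    {f : (Fin n → ℝ) → ℝ} (hf : IsCbSmooth f) (h : Fin n → L2 T) : Jet T P p k :=
  WithLp.toLp p ((memLp_smoothFun hW p hf h).toLp _,
    WithLp.toLp p fun l ↦ (memLp_smoothDeriv hW p hf h ((l : ℕ) + 1)).toLp _)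

/-- The class `𝒮_b` of smooth bounded random variables, with their derivatives up to order `k`. -/
def smoothJets (hW : IsWienerProcess W P) (p : ENNReal) (k : ℕ) : Set (Jet T P p k) :=
  {F | ∃ (n : ℕ) (f : (Fin n → ℝ) → ℝ) (hf : IsCbSmooth f) (h : Fin n → L2 T),
    F = smoothJet hW p k hf h}

/-- `h ∈ L²([0,T])` is (the class of) a continuous function on `[0,T]`. -/
def IsContinuousClass (h : L2 T) : Prop :=
  ∃ φ : ℝ → ℝ, ContinuousOn φ (Set.Icc 0 T) ∧ h =ᵐ[leb T] φ

/-- The class `𝒮_{∞,b}` of smooth bounded random variables `F = f(I(h_1),…,I(h_n))` with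
continuous `h_1,…,h_n`, with their derivatives up to order `k`. -/
def smoothContJets (hW : IsWienerProcess W P) (p : ENNReal) (k : ℕ) : Set (Jet T P p k) :=
  {F | ∃ (n : ℕ) (f : (Fin n → ℝ) → ℝ) (hf : IsCbSmooth f) (h : Fin n → L2 T),
    (∀ m, IsContinuousClass (h m)) ∧ F = smoothJet hW p k hf h}

/-- The Sobolev–Watanabe space `𝔻^{k,p}`, the closure of `𝒮_b` in the norm
`(E|F|^p + ∑_{l=1}^k E‖D^l F‖^p)^{1/p}`, realized as the closure of the graph of
`F ↦ (D¹F, …, D^k F)` on `𝒮_b`; an element is stored with its Malliavin derivatives.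
(The set `𝒮_b` is a vector space; the span only packages it as a submodule.) -/
def sobolev (hW : IsWienerProcess W P) (p : ENNReal) [Fact (1 ≤ p)] (k : ℕ) :
    Submodule ℝ (Jet T P p k) :=
  (Submodule.span ℝ (smoothJets hW p k)).topologicalClosure

/-- `g` is an elementary process with values in `𝒮_{∞,b}`: for some partition
`0 = t_0 ≤ t_1 ≤ ⋯ ≤ t_n = T` and some `G_0,…,G_{n-1} ∈ 𝒮_{∞,b}`,
`g = ∑_{i<n} G_i 1_{[t_i,t_{i+1})}` in `L^q([0,T], 𝔻^{k,p})`. -/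
def IsElementary (hW : IsWienerProcess W P) {p q : ENNReal} [Fact (1 ≤ p)] {k : ℕ}
    (g : Lp (sobolev hW p k) q (leb T)) : Prop :=
  ∃ (n : ℕ) (t : Fin (n + 1) → ℝ) (G : Fin n → sobolev hW p k),
    Monotone t ∧ t 0 = 0 ∧ t (Fin.last n) = T ∧
    (∀ i, (G i : Jet T P p k) ∈ smoothContJets hW p k) ∧
    g =ᵐ[leb T] fun s ↦ ∑ i : Fin n,
      (Set.Ico (t i.castSucc) (t i.succ)).indicator (fun _ ↦ G i) s

end WienerMalliavin

end

/-!
The proof separates the time variable from the random variable.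

In time, for any dense subset `D` of a normed space `E`, the step functions on partitions of `[0,T]`
with values in `D` are dense in `L^q([0,T]; E)` (`dense_step`). Compactly supported continuous
functions are dense there, and the sum of `c_i 1_{[t_i,t_{i+1})}`, with `c_i ∈ D` close to the value
at the node `t_i` of a fine partition, is uniformly close to such a function on `[0,T)`.
Approximating by a single step function in this way avoids adding step functions on different
partitions.

It remains to see that `𝒮_{∞,b}` is dense in `𝔻^{k,p}` (`dense_smoothCont`). For fixed
`f ∈ C_b^∞(ℝⁿ)`, the jet of `f(I(h_1),…,I(h_n))` is a continuous function of the kernels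
`h_1,…,h_n ∈ L²([0,T])` (`continuous_smoothJet`): the coefficients are bounded continuous functions
of the isometric images `I(h_m)`, hence continuous into `L^p(Ω)` (`continuous_toLp_comp`), and the
tensor product is a bounded multilinear map (`norm_tensor`). As continuous kernels are dense in
`L²([0,T])`, the closure of `𝒮_{∞,b}` contains `𝒮_b`. Since `𝒮_{∞,b}` is a linear space
(`smoothContSubmodule`), its closure contains the closed span of `𝒮_b`, which is `𝔻^{k,p}`.
-/

noncomputable section

namespace WienerMalliavin

open Filter Topology

/-! ### Continuity of the tensor product -/

section Tensor

variable {T : ℝ} {l : ℕ}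

theorem coeFn_tensor (h : Fin l → L2 T) :
    tensor h =ᵐ[Measure.pi fun _ : Fin l ↦ leb T] fun x ↦ ∏ j, h j (x j) :=
  (memLp_tensor h).coeFn_toLp

theorem norm_tensor (h : Fin l → L2 T) : ‖tensor h‖ = ∏ j, ‖h j‖ := by
  have hsq : ‖tensor h‖ ^ 2 = (∏ j, ‖h j‖) ^ 2 := by
    have hint : inner ℝ (tensor h) (tensor h) =
        ∫ x : Fin l → ℝ, ∏ j, (h j (x j) * h j (x j)) ∂(Measure.pi fun _ ↦ leb T) := by
      rw [L2.inner_def]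
      refine integral_congr_ae ?_
      filter_upwards [coeFn_tensor h] with x hx
      simp only [hx, RCLike.inner_apply, conj_trivial, Finset.prod_mul_distrib]
    rw [← real_inner_self_eq_norm_sq, hint,
      integral_fintype_prod_eq_prod (fun j y ↦ h j y * h j y), ← Finset.prod_pow]
    refine Finset.prod_congr rfl fun j _ ↦ ?_
    rw [← real_inner_self_eq_norm_sq, L2.inner_def]
    exact integral_congr_ae (Eventually.of_forall fun x ↦ by simp [sq])
  exact (sq_eq_sq₀ (norm_nonneg _) (Finset.prod_nonneg fun _ _ ↦ norm_nonneg _)).1 hsq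

theorem ae_eval {q : ℝ → Prop} (hq : ∀ᵐ y ∂(leb T), q y) (j : Fin l) :
    ∀ᵐ x ∂(Measure.pi fun _ : Fin l ↦ leb T), q (x j) :=
  (Measure.quasiMeasurePreserving_eval (fun _ : Fin l ↦ leb T) j).ae hq

/-- The tensor product as a continuous multilinear map. -/
def tensorMultilinear (T : ℝ) (l : ℕ) :
    ContinuousMultilinearMap ℝ (fun _ : Fin l ↦ L2 T) (L2Pow T l) :=
  MultilinearMap.mkContinuous
    { toFun := tensor
      map_update_add' := fun {inst} h i u v ↦ by
        obtain rfl := Subsingleton.elim inst (instDecidableEqFin l)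
        refine Lp.ext ?_
        filter_upwards [coeFn_tensor (Function.update h i (u + v)),
          Lp.coeFn_add (tensor (Function.update h i u)) (tensor (Function.update h i v)),
          coeFn_tensor (Function.update h i u), coeFn_tensor (Function.update h i v),
          ae_eval (Lp.coeFn_add u v) i] with x h1 h2 h3 h4 h5
        simp only [h1, h2, Pi.add_apply, h3, h4]
        rw [← Finset.mul_prod_erase _ _ (Finset.mem_univ i),
          ← Finset.mul_prod_erase _ _ (Finset.mem_univ i),
          ← Finset.mul_prod_erase _ _ (Finset.mem_univ i)]
        simp only [Function.update_self, h5, Pi.add_apply, add_mul]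
        congr 2 <;>
        · refine Finset.prod_congr rfl fun j hj ↦ ?_
          simp [Function.update_of_ne (Finset.ne_of_mem_erase hj)]
      map_update_smul' := fun {inst} h i c u ↦ by
        obtain rfl := Subsingleton.elim inst (instDecidableEqFin l)
        refine Lp.ext ?_
        filter_upwards [coeFn_tensor (Function.update h i (c • u)),
          Lp.coeFn_smul c (tensor (Function.update h i u)),
          coeFn_tensor (Function.update h i u), ae_eval (Lp.coeFn_smul c u) i] with x h1 h2 h3 h5
        simp only [h1, h2, Pi.smul_apply, h3, smul_eq_mul]
        rw [← Finset.mul_prod_erase _ _ (Finset.mem_univ i),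
          ← Finset.mul_prod_erase _ _ (Finset.mem_univ i)]
        simp only [Function.update_self, h5, Pi.smul_apply, smul_eq_mul, mul_assoc]
        congr 2
        refine Finset.prod_congr rfl fun j hj ↦ ?_
        simp [Function.update_of_ne (Finset.ne_of_mem_erase hj)] }
    1 fun h ↦ by rw [one_mul]; exact (norm_tensor h).le

theorem continuous_tensor : Continuous (tensor : (Fin l → L2 T) → L2Pow T l) :=
  (tensorMultilinear T l).cont

end Tensor

/-! ### Continuity of the jet in the kernels -/

section Continuity

variable {Ω : Type*} [MeasurableSpace Ω] {P : Measure Ω} [IsFiniteMeasure P]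

/-- A bounded continuous function of finitely many square integrable random variables depends
continuously on them, as an element of `L^p` for every finite `p`: along a subsequence, `L²`
convergence is almost sure convergence, and boundedness gives uniform integrability. -/
theorem continuous_toLp_comp {p : ENNReal} [Fact (1 ≤ p)] (hp : p ≠ ⊤) {n : ℕ}
    {g : (Fin n → ℝ) → ℝ} (hg : Continuous g) {C : ℝ} (hC : ∀ x, |g x| ≤ C)
    (hm : ∀ X : Fin n → Lp ℝ 2 P, MemLp (fun ω ↦ g fun m ↦ X m ω) p P) :
    Continuous fun X : Fin n → Lp ℝ 2 P ↦ (hm X).toLp (fun ω ↦ g fun m ↦ X m ω) := by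
  rw [continuous_iff_seqContinuous]
  intro X Y hXY
  refine tendsto_of_subseq_tendsto fun ns hns ↦ ?_
  have hY : ∀ m, Tendsto (fun N ↦ X (ns N) m) atTop (𝓝 (Y m)) := fun m ↦
    (tendsto_pi_nhds.1 hXY m).comp hns
  -- The sum of the coordinate distances tends to zero in `L²`, so one subsequence serves all
  -- coordinates.
  have hS : Tendsto (fun N ↦ eLpNorm (∑ m, fun ω ↦ ‖(X (ns N) m - Y m : Lp ℝ 2 P) ω‖) 2 P)
      atTop (𝓝 0) := by
    refine tendsto_of_tendsto_of_tendsto_of_le_of_le tendsto_const_nhds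
      (h := fun N ↦ ∑ m, ‖X (ns N) m - Y m‖ₑ) ?_ (fun _ ↦ zero_le) fun N ↦ ?_
    · have h0 : ∀ m, Tendsto (fun N ↦ ‖X (ns N) m - Y m‖ₑ) atTop (𝓝 0) := fun m ↦ by
        simpa only [edist_eq_enorm_sub] using tendsto_iff_edist_tendsto_0.1 (hY m)
      simpa only [Finset.sum_const_zero] using
        tendsto_finsetSum (Finset.univ : Finset (Fin n)) fun m _ ↦ h0 m
    · refine (eLpNorm_sum_le (fun m _ ↦ (Lp.aestronglyMeasurable _).norm) (by norm_num)).trans ?_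
      refine Finset.sum_le_sum fun m _ ↦ ?_
      rw [eLpNorm_norm, Lp.enorm_def]
  have hmeas : TendstoInMeasure P (fun N ↦ ∑ m, fun ω ↦ ‖(X (ns N) m - Y m : Lp ℝ 2 P) ω‖)
      atTop 0 := by
    refine tendstoInMeasure_of_tendsto_eLpNorm (p := 2) (by norm_num) (fun N ↦ ?_)
      aestronglyMeasurable_zero (by simpa using hS)
    exact Finset.aestronglyMeasurable_sum _ fun m _ ↦ (Lp.aestronglyMeasurable _).norm
  obtain ⟨ms, -, hms⟩ := hmeas.exists_seq_tendsto_ae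
  refine ⟨ms, ?_⟩
  refine (Lp.tendsto_Lp_iff_tendsto_eLpNorm'' _ (fun N ↦ hm (X (ns (ms N)))) _ (hm Y)).2 ?_
  refine tendsto_Lp_finite_of_tendsto_ae Fact.out hp (fun N ↦ (hm _).1) (hm _) ?_ ?_
  · refine unifIntegrable_of Fact.out hp (fun N ↦ (hm _).1) fun ε _ ↦
      ⟨(C + 1).toNNReal, fun N ↦ ?_⟩
    have : {x | (C + 1).toNNReal ≤ ‖g fun m ↦ X (ns (ms N)) m x‖₊} = ∅ := by
      ext x
      simp only [Set.mem_ofPred_eq, Set.mem_empty_iff_false, iff_false, not_le]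
      rw [← NNReal.coe_lt_coe, coe_nnnorm, Real.norm_eq_abs]
      exact ((hC _).trans_lt (lt_add_one C)).trans_le (Real.le_coe_toNNReal _)
    rw [this]
    simp
  · filter_upwards [hms, ae_all_iff.2 fun N ↦ ae_all_iff.2 fun m ↦
      Lp.coeFn_sub (X (ns (ms N)) m) (Y m)] with ω hω hsub
    refine (hg.tendsto _).comp (tendsto_pi_nhds.2 fun m ↦ ?_)
    rw [tendsto_iff_norm_sub_tendsto_zero]
    refine squeeze_zero (fun _ ↦ norm_nonneg _) (fun N ↦ ?_) hω
    rw [Finset.sum_apply]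
    refine le_trans (le_of_eq ?_) (Finset.single_le_sum
      (f := fun m ↦ ‖(X (ns (ms N)) m - Y m : Lp ℝ 2 P) ω‖) (fun _ _ ↦ norm_nonneg _)
      (Finset.mem_univ m))
    simp only [hsub N m, Pi.sub_apply]

variable {T : ℝ} {W : Set.Icc (0 : ℝ) T → Ω → ℝ}

/-- For fixed `f ∈ C_b^∞(ℝⁿ)` the jet of `f(I(h_1),…,I(h_n))` depends continuously on the
kernels `h_1,…,h_n ∈ L²([0,T])`. -/
theorem continuous_smoothJet (hW : IsWienerProcess W P) {p : ENNReal} [Fact (1 ≤ p)] (hp : p ≠ ⊤)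
    (k : ℕ) {n : ℕ} {f : (Fin n → ℝ) → ℝ} (hf : IsCbSmooth f) :
    Continuous fun h : Fin n → L2 T ↦ smoothJet hW p k hf h := by
  have hI : Continuous fun h : Fin n → L2 T ↦ fun m ↦ hW.integral (h m) :=
    continuous_pi fun m ↦ hW.integral.continuous.comp (continuous_apply m)
  have hX : ∀ {g : (Fin n → ℝ) → ℝ}, Continuous g → (∃ C, ∀ x, |g x| ≤ C) →
      ∀ X : Fin n → Lp ℝ 2 P, MemLp (fun ω ↦ g fun m ↦ X m ω) p P := by
    rintro g hg ⟨C, hC⟩ X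
    refine MemLp.of_bound ?_ C (Eventually.of_forall fun ω ↦ hC _)
    exact hg.comp_aestronglyMeasurable (aemeasurable_pi_lambda _ fun m ↦
      (Lp.aestronglyMeasurable (X m)).aemeasurable).aestronglyMeasurable
  refine (WithLp.prod_continuous_toLp p _ _).comp (Continuous.prodMk ?_
    ((PiLp.continuous_toLp p _).comp (continuous_pi fun l ↦ ?_)))
  · have hb : ∃ C, ∀ x, |f x| ≤ C := by
      obtain ⟨C, hC⟩ := hf.bounded 0 Fin.elim0
      exact ⟨C, fun x ↦ by simpa [partialDeriv] using hC x⟩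
    obtain ⟨C, hC⟩ := id hb
    exact (continuous_toLp_comp hp hf.smooth.continuous hC (hX hf.smooth.continuous hb)).comp hI
  · -- The derivative is a sum of images of pairs (coefficient, tensor) under the bilinear map
    -- `(v, φ) ↦ φ • v`.
    let B := ContinuousLinearMap.compLpL₂ p P
      ((ContinuousLinearMap.lsmul ℝ ℝ : ℝ →L[ℝ] L2Pow T ((l : ℕ) + 1) →L[ℝ] _).flip)
    have hφ : ∀ i : Fin ((l : ℕ) + 1) → Fin n, Continuous fun h : Fin n → L2 T ↦
        B (tensor fun j ↦ h (i j)) ((hX (hf.continuous_partialDeriv i) (hf.bounded _ i)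
          fun m ↦ hW.integral (h m)).toLp _) := by
      intro i
      obtain ⟨C, hC⟩ := hf.bounded _ i
      have h1 := (continuous_toLp_comp hp (hf.continuous_partialDeriv i) hC
        (hX (hf.continuous_partialDeriv i) (hf.bounded _ i))).comp hI
      have h2 : Continuous fun h : Fin n → L2 T ↦ tensor fun j ↦ h (i j) :=
        continuous_tensor.comp (continuous_pi fun j ↦ continuous_apply (i j))
      exact (B.continuous.comp h2).clm_apply h1
    refine (continuous_finsetSum Finset.univ fun i _ ↦ hφ i).congr fun h ↦ ?_
    refine Lp.ext ?_
    filter_upwards [Lp.coeFn_finsetSum Finset.univ fun i : Fin ((l : ℕ) + 1) → Fin n ↦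
        B (tensor fun j ↦ h (i j)) ((hX (hf.continuous_partialDeriv i) (hf.bounded _ i)
          fun m ↦ hW.integral (h m)).toLp _),
      (memLp_smoothDeriv hW p hf h ((l : ℕ) + 1)).coeFn_toLp,
      ae_all_iff.2 fun i : Fin ((l : ℕ) + 1) → Fin n ↦ ContinuousLinearMap.coeFn_compLp
        ((ContinuousLinearMap.lsmul ℝ ℝ : ℝ →L[ℝ] L2Pow T ((l : ℕ) + 1) →L[ℝ] _).flip
          (tensor fun j ↦ h (i j)))
        ((hX (hf.continuous_partialDeriv i) (hf.bounded _ i)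
          fun m ↦ hW.integral (h m)).toLp _),
      ae_all_iff.2 fun i : Fin ((l : ℕ) + 1) → Fin n ↦
        (hX (hf.continuous_partialDeriv i) (hf.bounded _ i)
          fun m ↦ hW.integral (h m)).coeFn_toLp] with ω h1 h2 h3 h4
    rw [h1, h2, smoothDeriv]
    refine (Finset.sum_apply _ _ _).trans (Finset.sum_congr rfl fun i _ ↦ ?_)
    refine (h3 i).trans ?_
    rw [h4 i]
    rfl

end Continuity
/-! ### Linear structure of the smooth random variables -/

section Linear

theorem IsCbSmooth.contDiff_nat {n : ℕ} {f : (Fin n → ℝ) → ℝ} (hf : IsCbSmooth f) (l : ℕ) :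
    ContDiff ℝ l f :=
  hf.smooth.of_le (by exact_mod_cast le_top)

theorem partialDeriv_add {n l : ℕ} {f g : (Fin n → ℝ) → ℝ} (hf : IsCbSmooth f)
    (hg : IsCbSmooth g) (i : Fin l → Fin n) (x : Fin n → ℝ) :
    partialDeriv (fun y ↦ f y + g y) i x = partialDeriv f i x + partialDeriv g i x := by
  simp only [partialDeriv]
  rw [fun_iteratedFDeriv_add_apply (hf.contDiff_nat l).contDiffAt (hg.contDiff_nat l).contDiffAt]
  rfl

theorem partialDeriv_const_mul {n l : ℕ} {f : (Fin n → ℝ) → ℝ} (hf : IsCbSmooth f)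
    (c : ℝ) (i : Fin l → Fin n) (x : Fin n → ℝ) :
    partialDeriv (fun y ↦ c * f y) i x = c * partialDeriv f i x := by
  have h := iteratedFDeriv_const_smul_apply' (a := c) (hf.contDiff_nat l).contDiffAt (x := x)
  simp only [partialDeriv]
  simp only [smul_eq_mul] at h
  rw [h]
  rfl

/-- Chain rule for a function of the coordinates selected by `σ`: a partial derivative in the
variables `i` collects the partial derivatives in all variables `c` that `σ` maps to `i`. -/
theorem partialDeriv_comp_reindex {n N l : ℕ} {f : (Fin n → ℝ) → ℝ} (hf : IsCbSmooth f)
    (σ : Fin n → Fin N) (i : Fin l → Fin N) (x : Fin N → ℝ) :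
    partialDeriv (fun y ↦ f fun m ↦ y (σ m)) i x =
      ∑ c : Fin l → Fin n with (fun j ↦ σ (c j)) = i, partialDeriv f c fun m ↦ x (σ m) := by
  classical
  let A : (Fin N → ℝ) →L[ℝ] (Fin n → ℝ) :=
    ContinuousLinearMap.pi fun m ↦ ContinuousLinearMap.proj (σ m)
  have hA : (fun y : Fin N → ℝ ↦ f fun m ↦ y (σ m)) = f ∘ A := rfl
  have he : ∀ a : Fin N, A (Pi.single a 1) =
      ∑ m : Fin n, (if σ m = a then (1 : ℝ) else 0) • (Pi.single m 1 : Fin n → ℝ) := by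
    intro a
    ext m
    simp [A, Finset.sum_apply, Pi.single_apply, -ite_smul]
  rw [partialDeriv, hA, A.iteratedFDeriv_comp_right (hf.contDiff_nat l) x le_rfl]
  simp only [ContinuousMultilinearMap.compContinuousLinearMap_apply, he]
  rw [ContinuousMultilinearMap.map_sum]
  simp only [ContinuousMultilinearMap.map_smul_univ]
  rw [Finset.sum_filter]
  refine Finset.sum_congr rfl fun c _ ↦ ?_
  by_cases hc : (fun j ↦ σ (c j)) = i
  · subst hc
    simp only [if_true, Finset.prod_const_one, one_smul]
    rfl
  · obtain ⟨j, hj⟩ := Function.ne_iff.1 hc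
    rw [if_neg hc, Finset.prod_eq_zero (Finset.mem_univ j) (if_neg hj), zero_smul]

theorem IsCbSmooth.add {n : ℕ} {f g : (Fin n → ℝ) → ℝ} (hf : IsCbSmooth f)
    (hg : IsCbSmooth g) : IsCbSmooth fun x ↦ f x + g x where
  smooth := hf.smooth.add hg.smooth
  bounded l i := by
    obtain ⟨C, hC⟩ := hf.bounded l i
    obtain ⟨D, hD⟩ := hg.bounded l i
    refine ⟨C + D, fun x ↦ ?_⟩
    rw [partialDeriv_add hf hg]
    exact (abs_add_le _ _).trans (add_le_add (hC x) (hD x))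

theorem IsCbSmooth.const_mul {n : ℕ} {f : (Fin n → ℝ) → ℝ} (hf : IsCbSmooth f) (c : ℝ) :
    IsCbSmooth fun x ↦ c * f x where
  smooth := contDiff_const.mul hf.smooth
  bounded l i := by
    obtain ⟨C, hC⟩ := hf.bounded l i
    refine ⟨|c| * C, fun x ↦ ?_⟩
    rw [partialDeriv_const_mul hf, abs_mul]
    exact mul_le_mul_of_nonneg_left (hC x) (abs_nonneg c)

theorem IsCbSmooth.comp_reindex {n N : ℕ} {f : (Fin n → ℝ) → ℝ} (hf : IsCbSmooth f)
    (σ : Fin n → Fin N) : IsCbSmooth fun x : Fin N → ℝ ↦ f fun m ↦ x (σ m) where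
  smooth := hf.smooth.comp (contDiff_pi.2 fun m ↦ contDiff_apply ℝ ℝ (σ m))
  bounded l i := by
    choose C hC using hf.bounded l
    refine ⟨∑ c : Fin l → Fin n with (fun j ↦ σ (c j)) = i, C c, fun x ↦ ?_⟩
    rw [partialDeriv_comp_reindex hf]
    exact (Finset.abs_sum_le_sum_abs _ _).trans (Finset.sum_le_sum fun c _ ↦ hC c _)

theorem isCbSmooth_zero (n : ℕ) : IsCbSmooth fun _ : Fin n → ℝ ↦ (0 : ℝ) where
  smooth := contDiff_const
  bounded l i := ⟨0, fun x ↦ by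
    rw [partialDeriv, show (fun _ : Fin n → ℝ ↦ (0 : ℝ)) = 0 from rfl, iteratedFDeriv_zero]
    simp⟩

variable {Ω : Type*} [MeasurableSpace Ω] {P : Measure Ω} {T : ℝ}
  {W : Set.Icc (0 : ℝ) T → Ω → ℝ}

theorem smoothDeriv_comp_reindex (hW : IsWienerProcess W P) {n N : ℕ} {f : (Fin n → ℝ) → ℝ}
    (hf : IsCbSmooth f) (σ : Fin n → Fin N) (h : Fin N → L2 T) (l : ℕ) :
    smoothDeriv hW (fun x ↦ f fun m ↦ x (σ m)) h l = smoothDeriv hW f (fun m ↦ h (σ m)) l := by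
  funext ω
  simp only [smoothDeriv]
  rw [Finset.sum_congr rfl fun i _ ↦ by rw [partialDeriv_comp_reindex hf, Finset.sum_smul],
    ← Finset.sum_fiberwise Finset.univ (fun (c : Fin l → Fin n) j ↦ σ (c j))
    (fun c ↦ partialDeriv f c (fun m ↦ hW.integral (h (σ m)) ω) • tensor fun j ↦ h (σ (c j)))]
  refine Finset.sum_congr rfl fun i _ ↦ Finset.sum_congr rfl fun c hc ↦ ?_
  rw [← (Finset.mem_filter.1 hc).2]

variable [IsFiniteMeasure P]

theorem smoothJet_comp_reindex (hW : IsWienerProcess W P) (p : ENNReal) (k : ℕ) {n N : ℕ}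
    {f : (Fin n → ℝ) → ℝ} (hf : IsCbSmooth f) (σ : Fin n → Fin N) (h : Fin N → L2 T) :
    smoothJet hW p k (hf.comp_reindex σ) h = smoothJet hW p k hf fun m ↦ h (σ m) := by
  simp only [smoothJet, smoothDeriv_comp_reindex hW hf]
  rfl

theorem smoothJet_add (hW : IsWienerProcess W P) (p : ENNReal) (k : ℕ) {n : ℕ}
    {f g : (Fin n → ℝ) → ℝ} (hf : IsCbSmooth f) (hg : IsCbSmooth g) (h : Fin n → L2 T) :
    smoothJet hW p k (hf.add hg) h = smoothJet hW p k hf h + smoothJet hW p k hg h := by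
  have hD : ∀ l, smoothDeriv hW (fun x ↦ f x + g x) h l =
      smoothDeriv hW f h l + smoothDeriv hW g h l := fun l ↦ by
    funext ω
    simp only [smoothDeriv, Pi.add_apply, partialDeriv_add hf hg, add_smul,
      Finset.sum_add_distrib]
  simp only [smoothJet, hD]
  rfl

theorem smoothJet_const_mul (hW : IsWienerProcess W P) (p : ENNReal) (k : ℕ) {n : ℕ}
    {f : (Fin n → ℝ) → ℝ} (hf : IsCbSmooth f) (c : ℝ) (h : Fin n → L2 T) :
    smoothJet hW p k (hf.const_mul c) h = c • smoothJet hW p k hf h := by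
  have hD : ∀ l, smoothDeriv hW (fun x ↦ c * f x) h l = c • smoothDeriv hW f h l := fun l ↦ by
    funext ω
    simp only [smoothDeriv, Pi.smul_apply, partialDeriv_const_mul hf, mul_smul,
      Finset.smul_sum]
  simp only [smoothJet, hD]
  rfl

theorem add_mem_smoothContJets (hW : IsWienerProcess W P) {p : ENNReal} {k : ℕ}
    {F G : Jet T P p k} (hF : F ∈ smoothContJets hW p k) (hG : G ∈ smoothContJets hW p k) :
    F + G ∈ smoothContJets hW p k := by
  obtain ⟨n, f, hf, h, hh, rfl⟩ := hF
  obtain ⟨m, g, hg, h', hh', rfl⟩ := hG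
  refine ⟨n + m, _, (hf.comp_reindex (Fin.castAdd m)).add (hg.comp_reindex (Fin.natAdd n)),
    Fin.append h h', fun j ↦ ?_, ?_⟩
  · induction j using Fin.addCases with
    | left j => simpa using hh j
    | right j => simpa using hh' j
  · rw [smoothJet_add hW p k (hf.comp_reindex (Fin.castAdd m)) (hg.comp_reindex (Fin.natAdd n)),
      smoothJet_comp_reindex hW p k hf (Fin.castAdd m) (Fin.append h h'),
      smoothJet_comp_reindex hW p k hg (Fin.natAdd n) (Fin.append h h'),
      funext (Fin.append_left h h'), funext (Fin.append_right h h')]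

theorem smul_mem_smoothContJets (hW : IsWienerProcess W P) {p : ENNReal} {k : ℕ} (c : ℝ)
    {F : Jet T P p k} (hF : F ∈ smoothContJets hW p k) : c • F ∈ smoothContJets hW p k := by
  obtain ⟨n, f, hf, h, hh, rfl⟩ := hF
  exact ⟨n, _, hf.const_mul c, h, hh, (smoothJet_const_mul hW p k hf c h).symm⟩

/-- The class `𝒮_{∞,b}`, with derivatives, as a linear space. -/
def smoothContSubmodule (hW : IsWienerProcess W P) (p : ENNReal) (k : ℕ) :
    Submodule ℝ (Jet T P p k) where
  carrier := smoothContJets hW p k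
  add_mem' := add_mem_smoothContJets hW
  smul_mem' c _ hF := smul_mem_smoothContJets hW c hF
  zero_mem' := by
    have h0 : smoothJet hW p k (isCbSmooth_zero 0) (Fin.elim0 : Fin 0 → L2 T) ∈
        smoothContJets hW p k := ⟨0, _, isCbSmooth_zero 0, _, fun m ↦ m.elim0, rfl⟩
    simpa using smul_mem_smoothContJets hW 0 h0

end Linear

/-! ### Density of smooth random variables with continuous kernels -/

section Density

theorem dense_isContinuousClass (T : ℝ) : Dense {h : L2 T | IsContinuousClass h} := by
  refine (BoundedContinuousFunction.toLp_denseRange (μ := leb T) ℝ ℝ (p := 2)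
    (by norm_num)).mono ?_
  rintro _ ⟨φ, rfl⟩
  exact ⟨φ, φ.continuous.continuousOn, BoundedContinuousFunction.coeFn_toLp 2 (leb T) ℝ φ⟩

variable {Ω : Type*} [MeasurableSpace Ω] {P : Measure Ω} [IsFiniteMeasure P]
  {T : ℝ} {W : Set.Icc (0 : ℝ) T → Ω → ℝ}

theorem smoothJets_subset_closure (hW : IsWienerProcess W P) {p : ENNReal} [Fact (1 ≤ p)]
    (hp : p ≠ ⊤) (k : ℕ) :
    smoothJets hW p k ⊆ closure (smoothContJets hW p k) := by
  rintro _ ⟨n, f, hf, h, rfl⟩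
  have hd : Dense (Set.pi Set.univ fun _ : Fin n ↦ {h : L2 T | IsContinuousClass h}) :=
    dense_pi _ fun _ _ ↦ dense_isContinuousClass T
  refine map_mem_closure (continuous_smoothJet hW hp k hf) (hd h) fun h' hh' ↦ ?_
  exact ⟨n, f, hf, h', fun m ↦ hh' m (Set.mem_univ m), rfl⟩

theorem sobolev_le_topologicalClosure (hW : IsWienerProcess W P) {p : ENNReal} [Fact (1 ≤ p)]
    (hp : p ≠ ⊤) (k : ℕ) :
    sobolev hW p k ≤ (smoothContSubmodule hW p k).topologicalClosure := by
  refine Submodule.topologicalClosure_minimal _ (Submodule.span_le.2 ?_)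
    (Submodule.isClosed_topologicalClosure _)
  exact smoothJets_subset_closure hW hp k

theorem dense_smoothCont (hW : IsWienerProcess W P) {p : ENNReal} [Fact (1 ≤ p)]
    (hp : p ≠ ⊤) (k : ℕ) :
    Dense {F : sobolev hW p k | (F : Jet T P p k) ∈ smoothContJets hW p k} := by
  intro F
  rw [Metric.mem_closure_iff]
  intro ε hε
  obtain ⟨G, hG, hd⟩ := Metric.mem_closure_iff.1 (sobolev_le_topologicalClosure hW hp k F.2) ε hε
  have hG' : G ∈ sobolev hW p k := by
    obtain ⟨n, f, hf, h, -, rfl⟩ := hG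
    exact Submodule.le_topologicalClosure _ (Submodule.subset_span ⟨n, f, hf, h, rfl⟩)
  exact ⟨⟨G, hG'⟩, hG, hd⟩

end Density

/-! ### Step processes in Bochner spaces -/

section Bochner

theorem sum_indicator_Ico_eq {E : Type*} [AddCommMonoid E] {n : ℕ} {t : Fin (n + 1) → ℝ}
    (ht : Monotone t) (c : Fin n → E) (i : Fin n) {s : ℝ}
    (hs : s ∈ Set.Ico (t i.castSucc) (t i.succ)) :
    ∑ j : Fin n, (Set.Ico (t j.castSucc) (t j.succ)).indicator (fun _ ↦ c j) s = c i := by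
  rw [Finset.sum_eq_single i, Set.indicator_of_mem hs]
  · intro j _ hj
    refine Set.indicator_of_notMem (fun hsj ↦ ?_) _
    rcases lt_or_gt_of_ne hj with h | h
    · exact absurd (hsj.2.trans_le ((ht (Fin.succ_le_castSucc_iff.2 h)).trans hs.1)) (lt_irrefl _)
    · exact absurd (hs.2.trans_le ((ht (Fin.succ_le_castSucc_iff.2 h)).trans hsj.1)) (lt_irrefl _)
  · simp

/-- A continuous function on `[0,T]` is uniformly close on `[0,T)` to a step function on a
partition of `[0,T]` whose values lie in a prescribed dense set. -/
theorem exists_step_near {E : Type*} [NormedAddCommGroup E] {D : Set E} (hD : Dense D) {T : ℝ}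
    (hT : 0 < T) {g : ℝ → E} (hg : Continuous g) {ε : ℝ} (hε : 0 < ε) :
    ∃ (n : ℕ) (t : Fin (n + 1) → ℝ) (c : Fin n → E), Monotone t ∧ t 0 = 0 ∧
      t (Fin.last n) = T ∧ (∀ i, c i ∈ D) ∧ ∀ s ∈ Set.Ico 0 T,
        ‖g s - ∑ i : Fin n,
          (Set.Ico (t i.castSucc) (t i.succ)).indicator (fun _ ↦ c i) s‖ ≤ ε := by
  obtain ⟨δ, hδ, hgδ⟩ := Metric.uniformContinuousOn_iff.1
    (isCompact_Icc.uniformContinuousOn_of_continuous (s := Set.Icc 0 T) hg.continuousOn)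
    (ε / 2) (half_pos hε)
  obtain ⟨n, hn⟩ := exists_nat_gt (T / δ)
  have hn0 : (0 : ℝ) < n := (div_pos hT hδ).trans hn
  have hmesh : T / n < δ := by
    rw [div_lt_iff₀ hδ] at hn
    rw [div_lt_iff₀ hn0]
    linarith
  choose c hcD hc using fun i : Fin n ↦
    Metric.mem_closure_iff.1 (hD (g ((i : ℕ) * (T / n)))) (ε / 2) (half_pos hε)
  have hTn : 0 < T / n := div_pos hT hn0
  have hmono : Monotone fun i : Fin (n + 1) ↦ ((i : ℕ) : ℝ) * (T / n) := fun i j hij ↦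
    mul_le_mul_of_nonneg_right (by exact_mod_cast hij) hTn.le
  refine ⟨n, fun i ↦ (i : ℕ) * (T / n), c, hmono, by simp, ?_, hcD, fun s hs ↦ ?_⟩
  · simp only [Fin.val_last]
    field_simp
  have hs0 : 0 ≤ s / (T / n) := div_nonneg hs.1 hTn.le
  have hfl : ⌊s / (T / n)⌋₊ < n := by
    rw [Nat.floor_lt hs0, div_lt_iff₀ hTn]
    have : (n : ℝ) * (T / n) = T := by field_simp
    rw [this]
    exact hs.2
  have h1 : (⌊s / (T / n)⌋₊ : ℝ) * (T / n) ≤ s :=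
    (le_div_iff₀ hTn).1 (Nat.floor_le hs0)
  have h2 : s < (⌊s / (T / n)⌋₊ + 1 : ℝ) * (T / n) :=
    (div_lt_iff₀ hTn).1 (Nat.lt_floor_add_one _)
  rw [sum_indicator_Ico_eq hmono c ⟨_, hfl⟩ ⟨h1, by simpa using h2⟩, ← dist_eq_norm]
  have h3 := hgδ s (Set.Ico_subset_Icc_self hs) (⌊s / (T / n)⌋₊ * (T / n))
    ⟨by positivity, h1.trans hs.2.le⟩ (by
      rw [Real.dist_eq, abs_of_nonneg (sub_nonneg.2 h1)]
      linarith)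
  have h4 := hc ⟨_, hfl⟩
  linarith [dist_triangle (g s) (g (⌊s / (T / n)⌋₊ * (T / n))) (c ⟨_, hfl⟩)]

theorem memLp_sum_indicator_Ico {E : Type*} [NormedAddCommGroup E] (μ : Measure ℝ)
    [IsFiniteMeasure μ] (q : ENNReal) {n : ℕ} (t : Fin (n + 1) → ℝ) (c : Fin n → E) :
    MemLp (fun s ↦ ∑ i : Fin n,
      (Set.Ico (t i.castSucc) (t i.succ)).indicator (fun _ ↦ c i) s) q μ :=
  memLp_finsetSum _ fun i _ ↦ memLp_indicator_const q measurableSet_Ico (c i)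
    (Or.inr (measure_ne_top μ _))

/-- Step functions on partitions of `[0,T]` with values in a dense set `D` are dense in
`L^q([0,T]; E)`: compactly supported continuous functions are dense, and such a function is
uniformly approximated by its values, moved into `D`, at the nodes of a fine partition. -/
theorem dense_step {E : Type*} [NormedAddCommGroup E] [NormedSpace ℝ E] {D : Set E}
    (hD : Dense D) {T : ℝ} (hT : 0 < T) {q : ENNReal} [Fact (1 ≤ q)] (hq : q ≠ ⊤) :
    Dense {g : Lp E q (leb T) | ∃ (n : ℕ) (t : Fin (n + 1) → ℝ) (c : Fin n → E),
      Monotone t ∧ t 0 = 0 ∧ t (Fin.last n) = T ∧ (∀ i, c i ∈ D) ∧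
      g =ᵐ[leb T] fun s ↦ ∑ i : Fin n,
        (Set.Ico (t i.castSucc) (t i.succ)).indicator (fun _ ↦ c i) s} := by
  intro f
  rw [EMetric.mem_closure_iff]
  intro ε hε
  obtain ⟨η, hη, hηε⟩ := exists_between hε
  have hη2 : η / 2 ≠ 0 := (ENNReal.half_pos hη.ne').ne'
  obtain ⟨g, -, hfg, hgc, hg⟩ :=
    (Lp.memLp f).exists_hasCompactSupport_eLpNorm_sub_le hq hη2
  -- The uniform error `r` is chosen so that it contributes at most `η / 2` in `L^q([0,T])`.
  obtain ⟨r, hr, hrη⟩ : ∃ r : ℝ, 0 < r ∧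
      leb T Set.univ ^ q.toReal⁻¹ * ENNReal.ofReal r ≤ η / 2 := by
    have hA : leb T Set.univ ^ q.toReal⁻¹ ≠ ⊤ :=
      ENNReal.rpow_ne_top_of_nonneg (by positivity) (measure_ne_top _ _)
    have hlim : Tendsto (fun r : ℝ ↦ leb T Set.univ ^ q.toReal⁻¹ * ENNReal.ofReal r)
        (𝓝[>] 0) (𝓝 0) := by
      have := ENNReal.Tendsto.const_mul (a := leb T Set.univ ^ q.toReal⁻¹)
        (ENNReal.tendsto_ofReal (tendsto_id (α := ℝ) (x := 𝓝 0))) (Or.inr hA)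
      simpa using this.mono_left nhdsWithin_le_nhds
    obtain ⟨r, hr, hr0⟩ := ((hlim.eventually_le_const (pos_iff_ne_zero.2 hη2)).and
      self_mem_nhdsWithin).exists
    exact ⟨r, hr0, hr⟩
  obtain ⟨n, t, c, ht, ht0, htT, hc, hgt⟩ := exists_step_near hD hT hgc hr
  have hmem := memLp_sum_indicator_Ico (leb T) q t c
  refine ⟨hmem.toLp _, ⟨n, t, c, ht, ht0, htT, hc, hmem.coeFn_toLp⟩, ?_⟩
  refine lt_of_le_of_lt ?_ hηε
  calc edist f (hmem.toLp _)
      ≤ edist f (hg.toLp g) + edist (hg.toLp g) (hmem.toLp _) := edist_triangle _ _ _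
    _ ≤ η / 2 + η / 2 := by
        refine add_le_add ?_ ?_
        · refine le_trans (le_of_eq ?_) hfg
          rw [← Lp.toLp_coeFn f (Lp.memLp f), Lp.edist_toLp_toLp]
          exact eLpNorm_congr_ae ((Lp.memLp f).coeFn_toLp.symm.sub ae_eq_rfl)
        · rw [Lp.edist_toLp_toLp]
          refine (eLpNorm_le_of_ae_bound ?_).trans hrη
          -- The endpoint `T` is excluded from every interval of the partition, but is a null set.
          have hne : ∀ᵐ s ∂(leb T), s ≠ T :=
            ae_restrict_of_ae (Measure.ae_ne volume T)
          filter_upwards [ae_restrict_mem measurableSet_Icc, hne] with s hs hsT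
          exact hgt s ⟨hs.1, lt_of_le_of_ne hs.2 hsT⟩
    _ = η := ENNReal.add_halves η

end Bochner

end WienerMalliavin

end

theorem lemmaA2 {Ω : Type*} [MeasurableSpace Ω] (P : Measure Ω) [IsProbabilityMeasure P]
    {T : ℝ} (hT : 0 < T) (W : Set.Icc (0 : ℝ) T → Ω → ℝ)
    (hW : WienerMalliavin.IsWienerProcess W P)
    (k : ℕ) (p q : ENNReal) [Fact (1 ≤ p)] [Fact (1 ≤ q)] (hp : p ≠ ⊤) (hq : q ≠ ⊤) :
    Dense {g : Lp (WienerMalliavin.sobolev hW p k) q (WienerMalliavin.leb T) |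
      WienerMalliavin.IsElementary hW g} := by
  exact WienerMalliavin.dense_step (WienerMalliavin.dense_smoothCont hW hp k) hT hq
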